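/- All topological spaces are assumed to be Hausdorff, and $C(L)$ denotes the real Banach algebra of continuous functions $L\to\mathbb R$ on a compact space $L$, with the sup norm. Let $\aleph$ be a cardinal. A compact space is an $F_\aleph$-space if any two disjoint open subsets, each of which is a union of fewer than $\aleph$ closed sets, have disjoint closures. An ultrafilter $\mathscr U$ on a set $I$ is countably incomplete if there is a decreasing sequence of members of $\mathscr U$ with empty intersection; it is $\aleph$-good if for every set $S$ with $|S|<\aleph$ and every $f:\operatorname{fin}(S)\to\mathscr U$ ($\operatorname{fin}(S)$ being the set of finite subsets of $S$) which is monotone ($f(B)\subset f(A)$ whenever $A\subset B$), there is a $g:\operatorname{fin}(S)\to\mathscr U$ which is multiplicative ($g(A\cup B)=g(A)\cap g(B)$) and satisfies $g(A)\subset f(A)$ for all $A$. Given compact spaces $(K_i)_{i\in I}$, let $\ell_\infty(C(K_i))$ be the Banach algebra of bounded families $(f_i)$ with $f_i\in C(K_i)$, with the supremum norm and the coordinatewise product, let $c_0^{\mathscr U}(C(K_i))$ be its closed ideal of families with $\lim_{\mathscr U}\|f_i\|=0$, and let $[C(K_i)]_{\mathscr U}=\ell_\infty(C(K_i))/c_0^{\mathscr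 U}(C(K_i))$, with the quotient norm. The topological ultracoproduct $(K_i)^{\mathscr U}$ is the maximal ideal space of $[C(K_i)]_{\mathscr U}$, that is, the space of its unital algebra homomorphisms to $\mathbb R$ with the relative weak* topology. **Proposition.** Let $\mathscr U$ be a countably incomplete, $\aleph$-good ultrafilter on $I$ and let $(K_i)_{i\in I}$ be a family of compact spaces. Then the topological ultracoproduct $(K_i)^{\mathscr U}$ is an $F_\aleph$-space (in particular, compact Hausdorff). Moreover, $\varphi\mapsto\ker\varphi$ is a bijection of $(K_i)^{\mathscr U}$ onto the set of maximal ideals of $[C(K_i)]_{\mathscr U}$; the Gelfand transform $[C(K_i)]_{\mathscr U}\to C((K_i)^{\mathscr U})$ is an isometric isomorphism of algebras; and every compact space $L$ such that $C(L)$ is isometrically isomorphic, as an algebra, to $[C(K_i)]_{\mathscr U}$ is homeomorphic to $(K_i)^{\mathscr U}$, and hence is an $F_\aleph$-space. -/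

import Mathlib

open Filter Topology Set

open scoped ENNReal

universe u v w x

namespace Ultracoproducts

noncomputable section

/-! Ultrafilters -/

/-- There is a decreasing sequence of members of the ultrafilter with empty intersection. -/
def CountablyIncomplete {I : Type u} (U : Ultrafilter I) : Prop :=
  ∃ s : ℕ → Set I, Antitone s ∧ (∀ n, s n ∈ U) ∧ ⋂ n, s n = ∅

open Classical in
/-- Keisler's `κ`-good ultrafilters: for every set `S` of cardinality less than `κ`, every monotone
map `f : fin(S) → U` (larger finite sets have smaller values) dominates a multiplicative map
`g : fin(S) → U`. -/
def IsGood {I : Type u} (κ : Cardinal.{w}) (U : Ultrafilter I) : Prop :=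
  ∀ S : Type w, Cardinal.mk S < κ →
    ∀ f : Finset S → Set I, (∀ A, f A ∈ U) → (∀ A B, A ⊆ B → f B ⊆ f A) →
      ∃ g : Finset S → Set I, (∀ A, g A ∈ U) ∧ (∀ A B, g (A ∪ B) = g A ∩ g B) ∧
        ∀ A, g A ⊆ f A

/-! `F_κ`-spaces -/

/-- `V` is the union of fewer than `κ` closed sets. -/
def IsUnionOfFewClosed {X : Type v} [TopologicalSpace X] (κ : Cardinal.{w}) (V : Set X) : Prop :=
  ∃ (J : Type w) (C : J → Set X), Cardinal.mk J < κ ∧ (∀ j, IsClosed (C j)) ∧ V = ⋃ j, C j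

/-- A compact (Hausdorff) space is an `F_κ`-space if any two disjoint open subsets which are unions
of fewer than `κ` closed sets have disjoint closures. -/
structure IsFSpace (κ : Cardinal.{w}) (X : Type v) [TopologicalSpace X] : Prop where
  compact : CompactSpace X
  hausdorff : T2Space X
  disjoint_closure : ∀ V W : Set X, IsOpen V → IsOpen W → IsUnionOfFewClosed κ V →
    IsUnionOfFewClosed κ W → Disjoint V W → Disjoint (closure V) (closure W)

/-! The Banach algebra `ℓ_∞(C(K_i))` -/

section

variable {I : Type u} (K : I → Type v) [∀ i, TopologicalSpace (K i)] [∀ i, CompactSpace (K i)]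

/-- The bounded families `(f_i)` with `f_i ∈ C(K_i)`, with the supremum norm. It is Mathlib's
`lp _ ∞`, under a name of its own because the unit is available also when some `K_i` are empty
(where the norm of `1 ∈ C(K_i)` is `0`). -/
def EllInfty : Type (max u v) := lp (fun i => C(K i, ℝ)) ∞

namespace EllInfty

instance : NonUnitalNormedCommRing (EllInfty K) :=
  inferInstanceAs (NonUnitalNormedCommRing (lp (fun i => C(K i, ℝ)) ∞))

instance : NormedSpace ℝ (EllInfty K) :=
  inferInstanceAs (NormedSpace ℝ (lp (fun i => C(K i, ℝ)) ∞))

instance : CompleteSpace (EllInfty K) :=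
  inferInstanceAs (CompleteSpace (lp (fun i => C(K i, ℝ)) ∞))

variable {K}

/-- The `i`-th coordinate of a bounded family. -/
def coord (f : EllInfty K) (i : I) : C(K i, ℝ) :=
  (show lp (fun i => C(K i, ℝ)) ∞ from f) i

theorem ext_coord {f g : EllInfty K} (h : ∀ i, coord f i = coord g i) : f = g :=
  lp.ext (funext h)

theorem norm_coord_le (f : EllInfty K) (i : I) : ‖coord f i‖ ≤ ‖f‖ :=
  lp.norm_apply_le_norm ENNReal.top_ne_zero _ i

variable (K)

theorem memℓp_one : Memℓp (fun i => (1 : C(K i, ℝ))) ∞ :=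
  memℓp_infty ⟨1, by
    rintro _ ⟨i, rfl⟩
    exact (ContinuousMap.norm_le _ zero_le_one).2 fun t => by simp⟩

instance : One (EllInfty K) :=
  ⟨show lp (fun i => C(K i, ℝ)) ∞ from ⟨fun _ => 1, memℓp_one K⟩⟩

variable {K}

@[simp] theorem coord_one (i : I) : coord (1 : EllInfty K) i = 1 := rfl
@[simp] theorem coord_zero (i : I) : coord (0 : EllInfty K) i = 0 := rfl
@[simp] theorem coord_add (f g : EllInfty K) (i : I) :
    coord (f + g) i = coord f i + coord g i := rfl
@[simp] theorem coord_sub (f g : EllInfty K) (i : I) :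
    coord (f - g) i = coord f i - coord g i := rfl
@[simp] theorem coord_mul (f g : EllInfty K) (i : I) :
    coord (f * g) i = coord f i * coord g i := rfl
@[simp] theorem coord_smul (r : ℝ) (f : EllInfty K) (i : I) :
    coord (r • f) i = r • coord f i := rfl

variable (K)

instance : NormedCommRing (EllInfty K) :=
  { (inferInstance : NonUnitalNormedCommRing (EllInfty K)),
    (inferInstance : One (EllInfty K)) with
    one_mul := fun f => ext_coord fun i => by simp
    mul_one := fun f => ext_coord fun i => by simp }

instance : Algebra ℝ (EllInfty K) :=
  Algebra.ofModule
    (fun r f g => ext_coord fun i => by simp)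
    (fun r f g => ext_coord fun i => by simp)

instance : NormedAlgebra ℝ (EllInfty K) where
  norm_smul_le := norm_smul_le

end EllInfty

/-! The ultraproduct of the algebras `C(K_i)` and the ultracoproduct of the spaces `K_i` -/

variable (U : Ultrafilter I)

/-- The ideal `c_0^U(C(K_i))` of the bounded families whose norms tend to `0` along `U`. -/
def nullIdeal : Ideal (EllInfty K) where
  carrier := {f | Tendsto (fun i => ‖f.coord i‖) U (𝓝 0)}
  zero_mem' := by simp
  add_mem' := by
    intro f g hf hg
    have hfg := Tendsto.add hf hg
    rw [add_zero] at hfg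
    exact squeeze_zero (fun _ => norm_nonneg _) (fun i => norm_add_le _ _) hfg
  smul_mem' := by
    intro c f hf
    have hcf := Tendsto.const_mul ‖c‖ hf
    rw [mul_zero] at hcf
    refine squeeze_zero (fun _ => norm_nonneg _) (fun i => ?_) hcf
    exact (norm_mul_le _ _).trans
      (mul_le_mul_of_nonneg_right (c.norm_coord_le i) (norm_nonneg _))

theorem mem_nullIdeal {f : EllInfty K} :
    f ∈ nullIdeal K U ↔ Tendsto (fun i => ‖f.coord i‖) U (𝓝 0) := Iff.rfl

instance isClosed_nullIdeal : IsClosed (nullIdeal K U : Set (EllInfty K)) := by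
  refine isClosed_of_closure_subset fun f hf => ?_
  change Tendsto (fun i => ‖f.coord i‖) U (𝓝 0)
  rw [Metric.tendsto_nhds]
  intro ε hε
  obtain ⟨g, hg, hfg⟩ := Metric.mem_closure_iff.1 hf (ε / 2) (half_pos hε)
  have hg' : Tendsto (fun i => ‖g.coord i‖) U (𝓝 0) := hg
  filter_upwards [(Metric.tendsto_nhds.1 hg') (ε / 2) (half_pos hε)] with i hi
  rw [dist_zero_right, norm_norm] at hi ⊢
  have h1 : ‖(f - g).coord i‖ ≤ ‖f - g‖ := EllInfty.norm_coord_le _ i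
  rw [dist_eq_norm] at hfg
  have h2 : ‖f.coord i‖ ≤ ‖(f - g).coord i‖ + ‖g.coord i‖ := by
    rw [EllInfty.coord_sub]
    exact norm_le_norm_sub_add _ _
  linarith

/-- The Banach algebra ultraproduct `[C(K_i)]_U = ℓ_∞(C(K_i)) / c_0^U(C(K_i))`, with the quotient
norm. -/
abbrev Ultraproduct : Type (max u v) := EllInfty K ⧸ nullIdeal K U

/-- The (topological) ultracoproduct `(K_i)^U`: the maximal ideal space of `[C(K_i)]_U`, that is,
its space of characters (real-valued unital algebra homomorphisms) with the weak* topology. -/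
abbrev Ultracoproduct : Type (max u v) := WeakDual.characterSpace ℝ (Ultraproduct K U)

/-- The algebras `C(L)` and `[C(K_i)]_U` are isometrically isomorphic, i.e. the compact space `L`
is a copy of the ultracoproduct. -/
def RepresentsUltraproduct (L : Type x) [TopologicalSpace L] [CompactSpace L] : Prop :=
  ∃ e : C(L, ℝ) ≃ₐ[ℝ] Ultraproduct K U, Isometry e

/-- The maximal ideal of `[C(K_i)]_U` belonging to a point of the ultracoproduct. -/
def toMaximalSpectrum (φ : Ultracoproduct K U) : MaximalSpectrum (Ultraproduct K U) :=
  ⟨RingHom.ker φ, inferInstance⟩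

end

end

end Ultracoproducts

/-!
Write `A` for the ultraproduct `[C(K_i)]_U` and `X` for its space of characters.

**Gelfand duality.** A class represented by nonnegative functions is a square, so characters are
monotone (`character_mono`) and hence contractive. Conversely, if `|f_i(t)| > c` at some `t ∈ K_i`
for `U`-many `i`, then a limit of evaluations along an ultrafilter of such points `(i, t)` lying
over `U` is a character whose value at `f` is at least `c` in absolute value
(`exists_character_tendsto`, `eventually_norm_coord_le`). So the Gelfand transform is isometric;
its range is closed and separates points, and the real Stone-Weierstrass theorem makes it
surjective. As `A` is now a copy of `C(X)` with `X` compact Hausdorff, its maximal ideals are the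
kernels of the points of `X`, and a compact Hausdorff `L` with `C(L)` isomorphic to `A` is
homeomorphic to `X`.

**The `F_κ` property.** Let `V = ⋃ C_j` and `W = ⋃ D_l` be disjoint open sets, the unions being of
fewer than `κ` closed sets. By Urysohn's lemma there are classes of families `F_j`, `G_l` with
values in `[0, 1]` which are `1` on `C_j`, `D_l` and `0` off `V`, `W`
(`exists_family_eq_one_eq_zero`; here the point is that characters commute with truncation,
`character_clamp`). The products `F_j G_l` vanish in `A`, so `‖F_j G_l‖ ≤ 1/3` at `U`-many
coordinates. Goodness and countable incompleteness provide, at each coordinate `i`, a finite set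
`T i` of active labels such that `‖F_j G_l‖ ≤ 1/3` at `i` for all active `j`, `l`, while every
label is active at `U`-many `i` (`IsGood.exists_pointwise_finite`). Let `P_i` be the supremum of
the active `F_j` at `i`. The class of `P` is at least `1` on `V`, because it dominates every `F_j`,
and at most `1/3` on `W`, because `P G_l ≤ 1/3` at `U`-many coordinates. Hence the closures of `V`
and `W` are disjoint.
-/

namespace Ultracoproducts

noncomputable section

open WeakDual

variable {I : Type u} {K : I → Type v} [∀ i, TopologicalSpace (K i)] [∀ i, CompactSpace (K i)]

/-! ### Bounded families -/

namespace EllInfty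

/-- A uniformly bounded family of continuous functions as an element of `ℓ_∞(C(K_i))`. -/
def ofBounded (f : ∀ i, C(K i, ℝ)) (c : ℝ) (hf : ∀ i, ‖f i‖ ≤ c) : EllInfty K :=
  show lp (fun i => C(K i, ℝ)) ∞ from ⟨f, memℓp_infty ⟨c, by rintro _ ⟨i, rfl⟩; exact hf i⟩⟩

@[simp] theorem coord_neg (f : EllInfty K) (i : I) : coord (-f) i = -coord f i := rfl

@[simp] theorem coord_ofBounded (f : ∀ i, C(K i, ℝ)) (c : ℝ) (hf : ∀ i, ‖f i‖ ≤ c) (i : I) :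
    coord (ofBounded f c hf) i = f i := rfl

theorem norm_le_of_coord {f : EllInfty K} {c : ℝ} (hc : 0 ≤ c) (hf : ∀ i, ‖coord f i‖ ≤ c) :
    ‖f‖ ≤ c :=
  lp.norm_le_of_forall_le hc hf

theorem abs_coord_le (f : EllInfty K) (i : I) (t : K i) : |coord f i t| ≤ ‖f‖ :=
  ((coord f i).norm_coe_le_norm t).trans (norm_coord_le f i)

end EllInfty

open EllInfty

variable {U : Ultrafilter I}

/-! ### Characters of the ultraproduct -/

/-- The class of a bounded family in the ultraproduct. -/
abbrev toUltraproduct (U : Ultrafilter I) : EllInfty K →ₐ[ℝ] Ultraproduct K U :=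
  Ideal.Quotient.mkₐ ℝ (nullIdeal K U)

theorem toUltraproduct_eq_of_eventually {f g : EllInfty K}
    (h : ∀ᶠ i in (U : Filter I), coord f i = coord g i) :
    toUltraproduct U f = toUltraproduct U g := by
  refine Ideal.Quotient.eq.2 ((mem_nullIdeal K U).2 ?_)
  refine tendsto_const_nhds.congr' ?_
  filter_upwards [h] with i hi
  simp [hi]

/-- A class represented by nonnegative functions is the square of the class of their square
roots, so characters are nonnegative on it. -/
theorem character_nonneg (φ : Ultracoproduct K U) {f : EllInfty K}
    (hf : ∀ᶠ i in (U : Filter I), ∀ t, 0 ≤ coord f i t) : 0 ≤ φ (toUltraproduct U f) := by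
  have hb : ∀ (i : I) (t : K i), √(max 0 (coord f i t)) ≤ √‖f‖ := fun i t =>
    Real.sqrt_le_sqrt (max_le (norm_nonneg _) ((le_abs_self _).trans (abs_coord_le f i t)))
  let r : EllInfty K := ofBounded
    (fun i => ⟨fun t => √(max 0 (coord f i t)), by fun_prop⟩) (√‖f‖) (fun i =>
      (ContinuousMap.norm_le _ (Real.sqrt_nonneg _)).2 fun t => by
        simpa [abs_of_nonneg] using hb i t)
  have h : toUltraproduct U f = toUltraproduct U r * toUltraproduct U r := by
    rw [← map_mul]
    refine toUltraproduct_eq_of_eventually ?_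
    filter_upwards [hf] with i hi
    ext t
    simp [r, Real.mul_self_sqrt, hi t]
  rw [h, map_mul]
  exact mul_self_nonneg _

theorem character_mono (φ : Ultracoproduct K U) {f g : EllInfty K}
    (h : ∀ᶠ i in (U : Filter I), ∀ t, coord f i t ≤ coord g i t) :
    φ (toUltraproduct U f) ≤ φ (toUltraproduct U g) := by
  have := character_nonneg φ (f := g - f) (by
    filter_upwards [h] with i hi t
    simpa using hi t)
  rw [map_sub, map_sub] at this
  linarith

theorem character_smul_one (φ : Ultracoproduct K U) (c : ℝ) :
    φ (toUltraproduct U (c • (1 : EllInfty K))) = c := by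
  rw [map_smul, map_one, map_smul, map_one, smul_eq_mul, mul_one]

theorem abs_character_le_norm (φ : Ultracoproduct K U) (f : EllInfty K) :
    |φ (toUltraproduct U f)| ≤ ‖f‖ := by
  rw [abs_le]
  constructor
  · rw [← character_smul_one φ (-‖f‖)]
    refine character_mono φ (.of_forall fun i t => ?_)
    simpa using (abs_le.1 (abs_coord_le f i t)).1
  · rw [← character_smul_one φ ‖f‖]
    refine character_mono φ (.of_forall fun i t => ?_)
    simpa using (abs_le.1 (abs_coord_le f i t)).2

/-- The truncation of a bounded family to values in `[0, 1]`. -/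
def clamp (f : EllInfty K) : EllInfty K :=
  ofBounded (fun i => ⟨fun t => max 0 (min 1 (coord f i t)), by fun_prop⟩) 1 fun i =>
    (ContinuousMap.norm_le _ zero_le_one).2 fun t => by
      simp [abs_of_nonneg]

theorem coord_clamp (f : EllInfty K) (i : I) (t : K i) :
    coord (clamp f) i t = max 0 (min 1 (coord f i t)) := rfl

theorem clamp_nonneg (f : EllInfty K) (i : I) (t : K i) : 0 ≤ coord (clamp f) i t :=
  le_max_left _ _

theorem clamp_le_one (f : EllInfty K) (i : I) (t : K i) : coord (clamp f) i t ≤ 1 :=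
  max_le zero_le_one (min_le_left _ _)

/-- Characters commute with the truncation to `[0, 1]`. Since the truncation `p` is `1`-Lipschitz,
`(p ∘ f - p(r))² ≤ (f - r)²`, and a character with value `r` at `f` kills the right-hand side. -/
theorem character_clamp (φ : Ultracoproduct K U) (f : EllInfty K) :
    φ (toUltraproduct U (clamp f)) = max 0 (min 1 (φ (toUltraproduct U f))) := by
  set r := φ (toUltraproduct U f) with hr
  set c := max 0 (min 1 r) with hc
  have h := character_mono φ
    (f := (clamp f - c • 1) * (clamp f - c • 1)) (g := (f - r • 1) * (f - r • 1)) (by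
      refine .of_forall fun i t => ?_
      have h1 : |max 0 (min 1 (coord f i t)) - max 0 (min 1 r)| ≤ |coord f i t - r| := by
        have h1 := abs_max_sub_max_le_max 0 (min 1 (coord f i t)) 0 (min 1 r)
        have h2 := abs_min_sub_min_le_max 1 (coord f i t) 1 r
        rw [sub_self, abs_zero] at h1 h2
        exact h1.trans (max_le (abs_nonneg _) (h2.trans (max_le (abs_nonneg _) le_rfl)))
      simpa [coord_clamp] using abs_le_iff_mul_self_le.1 h1)
  simp only [map_mul, map_sub, character_smul_one, ← hr, sub_self, mul_zero] at h
  have := mul_self_eq_zero.1 (le_antisymm h (mul_self_nonneg _))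
  linarith

/-! ### Limits along ultrafilters of points -/

/-- The character `f ↦ lim_W f_i(t)` given by an ultrafilter `W` of points `(i, t)` lying
over `U`. -/
theorem exists_character_tendsto (W : Ultrafilter (Σ i, K i)) (hW : Tendsto Sigma.fst (W : Filter (Σ i, K i)) (U : Filter I)) :
    ∃ φ : Ultracoproduct K U, ∀ f : EllInfty K,
      Tendsto (fun p : Σ i, K i => coord f p.1 p.2) W (𝓝 (φ (toUltraproduct U f))) := by
  have hlim : ∀ f : EllInfty K, ∃ r : ℝ,
      Tendsto (fun p : Σ i, K i => coord f p.1 p.2) W (𝓝 r) := fun f => by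
    obtain ⟨r, -, hr⟩ := (isCompact_Icc (a := -‖f‖) (b := ‖f‖)).ultrafilter_le_nhds
      (W.map fun p : Σ i, K i => coord f p.1 p.2) (by
        refine le_principal_iff.2 (Filter.mem_map.2 ?_)
        exact Filter.univ_mem' fun p : Σ i, K i => abs_le.1 (abs_coord_le f p.1 p.2))
    exact ⟨r, hr⟩
  choose ψ hψ using hlim
  let Ψ : EllInfty K →ₐ[ℝ] ℝ := AlgHom.ofLinearMap
    { toFun := ψ
      map_add' := fun f g => tendsto_nhds_unique (hψ _) ((hψ f).add (hψ g))
      map_smul' := fun c f => tendsto_nhds_unique (hψ _) ((hψ f).const_mul c) }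
    (tendsto_nhds_unique (hψ _) tendsto_const_nhds)
    (fun f g => tendsto_nhds_unique (hψ _) ((hψ f).mul (hψ g)))
  have hnull : ∀ f ∈ nullIdeal K U, Ψ f = 0 := fun f hf => by
    have h0 : Tendsto (fun p : Σ i, K i => ‖coord f p.1‖) W (𝓝 0) :=
      ((mem_nullIdeal K U).1 hf).comp hW
    exact tendsto_nhds_unique (hψ f)
      (squeeze_zero_norm (fun p => (coord f p.1).norm_coe_le_norm p.2) h0)
  refine ⟨CharacterSpace.equivAlgHom.symm (Ideal.Quotient.liftₐ (nullIdeal K U) Ψ hnull),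
    fun f => ?_⟩
  exact hψ f

/-- If `‖f_i‖ ≤ c` for `U`-many `i`, the class of `f` has norm at most `c`. -/
theorem norm_toUltraproduct_le {f : EllInfty K} {c : ℝ} (hc : 0 ≤ c)
    (hf : ∀ᶠ i in (U : Filter I), ‖coord f i‖ ≤ c) : ‖toUltraproduct U f‖ ≤ c := by
  classical
  -- The coordinates that exceed the bound may be replaced by `0`.
  let g : EllInfty K := ofBounded (fun i => if ‖coord f i‖ ≤ c then coord f i else 0) c fun i => by
    split_ifs with h
    · exact h
    · simpa using hc
  have h : toUltraproduct U f = toUltraproduct U g := by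
    refine toUltraproduct_eq_of_eventually ?_
    filter_upwards [hf] with i hi
    simp [g, hi]
  rw [h]
  refine (Ideal.Quotient.norm_mk_le _ _).trans (norm_le_of_coord hc fun i => ?_)
  simp only [g, coord_ofBounded]
  split_ifs with h
  · exact h
  · simpa using hc

/-- If all characters are smaller than `c` at `f`, then `‖f_i‖ ≤ c` for `U`-many `i`: otherwise a
limit along points `(i, t)` with `|f_i(t)| > c` would be a character of value at least `c`. -/
theorem eventually_norm_coord_le {f : EllInfty K} {c : ℝ} (hc : 0 ≤ c)
    (h : ∀ φ : Ultracoproduct K U, |φ (toUltraproduct U f)| < c) :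
    ∀ᶠ i in (U : Filter I), ‖coord f i‖ ≤ c := by
  by_contra hne
  rw [← Ultrafilter.eventually_not] at hne
  let s : Set (Σ i, K i) := {p | c < |coord f p.1 p.2|}
  have hs : Sigma.fst '' s ∈ U := by
    filter_upwards [hne] with i hi
    rw [ContinuousMap.norm_le _ hc] at hi
    push Not at hi
    obtain ⟨t, ht⟩ := hi
    exact ⟨⟨i, t⟩, ht, rfl⟩
  let W := Ultrafilter.ofComapInfPrincipal hs
  have hWs : s ∈ W := Ultrafilter.ofComapInfPrincipal_mem hs
  obtain ⟨φ, hφ⟩ := exists_character_tendsto (U := U) W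
    (Ultrafilter.coe_le_coe.2 (Ultrafilter.ofComapInfPrincipal_eq_of_map hs))
  refine (h φ).not_ge (ge_of_tendsto (hφ f).abs ?_)
  filter_upwards [hWs] with p hp using le_of_lt hp

/-! ### The Gelfand transform and maximal ideals -/

theorem isometry_gelfandTransform : Isometry (gelfandTransform ℝ (Ultraproduct K U)) := by
  refine AddMonoidHomClass.isometry_of_norm (gelfandTransform ℝ (Ultraproduct K U)) fun a => le_antisymm ?_ ?_
  · refine (ContinuousMap.norm_le _ (norm_nonneg a)).2 fun φ => ?_
    refine le_of_forall_pos_le_add fun ε hε => ?_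
    obtain ⟨f, rfl, hf⟩ := Ideal.Quotient.norm_mk_lt a hε
    exact (abs_character_le_norm φ f).trans hf.le
  · refine le_of_forall_pos_le_add fun ε hε => ?_
    obtain ⟨f, rfl⟩ := Ideal.Quotient.mk_surjective a
    have hpos : 0 ≤ ‖gelfandTransform ℝ (Ultraproduct K U) (toUltraproduct U f)‖ + ε := by
      positivity
    refine norm_toUltraproduct_le hpos (eventually_norm_coord_le hpos fun φ => ?_)
    exact (ContinuousMap.norm_coe_le_norm
      (gelfandTransform ℝ (Ultraproduct K U) (toUltraproduct U f)) φ).trans_lt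
        (lt_add_of_pos_right _ hε)

/-- Surjectivity is the Stone-Weierstrass theorem: the range is closed, and it separates points. -/
theorem bijective_gelfandTransform :
    Function.Bijective (gelfandTransform ℝ (Ultraproduct K U)) := by
  refine ⟨isometry_gelfandTransform.injective, ?_⟩
  let rng := (gelfandTransform ℝ (Ultraproduct K U)).range
  have hclosed : rng.topologicalClosure = rng := le_antisymm
    (Subalgebra.topologicalClosure_minimal le_rfl
      (isometry_gelfandTransform (K := K) (U := U)).isClosedEmbedding.isClosed_range)
    (Subalgebra.le_topologicalClosure _)
  have hsep : rng.SeparatesPoints := by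
    intro φ ψ
    contrapose!
    exact fun h => CharacterSpace.ext fun a =>
      h (gelfandTransform ℝ (Ultraproduct K U) a)
        ⟨gelfandTransform ℝ (Ultraproduct K U) a, ⟨a, rfl⟩, rfl⟩
  have htop := ContinuousMap.subalgebra_topologicalClosure_eq_top_of_separatesPoints rng hsep
  rw [hclosed] at htop
  exact fun h => show h ∈ rng from htop ▸ Algebra.mem_top

/-- A maximal ideal of an algebra isomorphic to `C(X)`, `X` compact Hausdorff, consists of the
elements vanishing at some point of `X`. -/
theorem exists_mem_iff_apply_eq_zero {X : Type v} [TopologicalSpace X] [CompactSpace X] [T2Space X]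
    {A : Type w} [CommRing A] [Algebra ℝ A] (e : A ≃ₐ[ℝ] C(X, ℝ)) (M : Ideal A)
    [hM : M.IsMaximal] : ∃ t : X, ∀ a, a ∈ M ↔ e a t = 0 := by
  let N : Ideal C(X, ℝ) := M.comap e.symm
  have hN : N.IsMaximal := Ideal.comap_isMaximal_of_surjective _ e.symm.surjective
  obtain ⟨t, ht⟩ := (ContinuousMap.ideal_isMaximal_iff N).1 hN
  refine ⟨t, fun a => ?_⟩
  have h : a ∈ M ↔ e a ∈ N := by simp [N]
  rw [h, ← ht, ContinuousMap.mem_idealOfSet_compl_singleton]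

theorem bijective_toMaximalSpectrum : Function.Bijective (toMaximalSpectrum K U) := by
  refine ⟨fun φ ψ h => CharacterSpace.ext_ker (congrArg MaximalSpectrum.asIdeal h), fun M => ?_⟩
  have hM := M.isMaximal
  obtain ⟨φ, hφ⟩ := exists_mem_iff_apply_eq_zero
    (AlgEquiv.ofBijective (gelfandTransform ℝ (Ultraproduct K U)) bijective_gelfandTransform)
    M.asIdeal
  exact ⟨φ, MaximalSpectrum.ext (Ideal.ext fun a => RingHom.mem_ker.trans (hφ a).symm)⟩

/-- A compact Hausdorff space `L` is the space of characters of `C(L)`, so it is determined by the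
algebra `C(L)`. -/
theorem nonempty_homeomorph_characterSpace {L : Type x} [TopologicalSpace L] [CompactSpace L]
    [T2Space L] {A : Type v} [NormedRing A] [NormedAlgebra ℝ A] [CompleteSpace A]
    (e : C(L, ℝ) ≃ₐ[ℝ] A) : Nonempty (L ≃ₜ characterSpace ℝ A) := by
  let F : L → characterSpace ℝ A := fun t => CharacterSpace.equivAlgHom.symm
    ((CharacterSpace.equivAlgHom (CharacterSpace.continuousMapEval L ℝ t)).comp e.symm.toAlgHom)
  have hF : ∀ t a, F t a = e.symm a t := fun t a => rfl
  have hcont : Continuous F := Continuous.subtype_mk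
    (WeakDual.continuous_of_continuous_eval fun a => (e.symm a).continuous) _
  have hbij : Function.Bijective F := by
    refine ⟨fun s t h => (CharacterSpace.continuousMapEval_bijective L ℝ).1
      (CharacterSpace.ext fun f => ?_), fun φ => ?_⟩
    · have := DFunLike.congr_fun h (e f)
      rwa [hF, hF, e.symm_apply_apply] at this
    · obtain ⟨t, ht⟩ := (CharacterSpace.continuousMapEval_bijective L ℝ).2
        (CharacterSpace.equivAlgHom.symm ((CharacterSpace.equivAlgHom φ).comp e.toAlgHom))
      refine ⟨t, CharacterSpace.ext fun a => ?_⟩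
      have h1 : e.symm a t = φ (e (e.symm a)) := DFunLike.congr_fun ht (e.symm a)
      rw [hF, h1, e.apply_symm_apply]
  exact ⟨hcont.homeoOfEquivCompactToT2 (f := Equiv.ofBijective F hbij)⟩

/-! ### Transfer of the `F_κ` property -/

theorem IsUnionOfFewClosed.preimage {X : Type v} {Y : Type x} [TopologicalSpace X]
    [TopologicalSpace Y] {κ : Cardinal.{w}} {V : Set Y} (hV : IsUnionOfFewClosed κ V) {h : X → Y}
    (hh : Continuous h) : IsUnionOfFewClosed κ (h ⁻¹' V) := by
  obtain ⟨J, C, hJ, hC, rfl⟩ := hV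
  exact ⟨J, fun j => h ⁻¹' C j, hJ, fun j => (hC j).preimage hh, preimage_iUnion⟩

theorem IsFSpace.of_homeomorph {X : Type v} {Y : Type x} [TopologicalSpace X]
    [TopologicalSpace Y] {κ : Cardinal.{w}} (hX : IsFSpace κ X) (h : Y ≃ₜ X) : IsFSpace κ Y where
  compact := by
    have := hX.compact
    exact h.symm.compactSpace
  hausdorff := by
    have := hX.hausdorff
    exact h.symm.t2Space
  disjoint_closure V W hVo hWo hV hW hVW := by
    have := hX.disjoint_closure (h.symm ⁻¹' V) (h.symm ⁻¹' W) (hVo.preimage h.symm.continuous)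
      (hWo.preimage h.symm.continuous) (hV.preimage h.symm.continuous)
      (hW.preimage h.symm.continuous) (hVW.preimage _)
    rw [← h.symm.preimage_closure, ← h.symm.preimage_closure] at this
    exact (disjoint_preimage_iff h.symm.surjective).1 this

/-! ### Good ultrafilters -/

/-- The form in which goodness is used: if `U`-many indices satisfy each of the fewer than `κ`
pairwise requirements `E a b`, then to every index `i` one can attach a finite set `T i` of labels
any two of which satisfy their requirement at `i`, in such a way that every label is attached to
`U`-many indices. Countable incompleteness makes the sets `T i` finite. -/
theorem IsGood.exists_pointwise_finite {κ : Cardinal.{w}} (hgood : IsGood κ U)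
    (hinc : CountablyIncomplete U) {S : Type w} (hS : Cardinal.mk S < κ) (E : S → S → Set I)
    (hE : ∀ a b, E a b ∈ U) :
    ∃ T : I → Set S, (∀ i, (T i).Finite) ∧ (∀ a, ∀ᶠ i in (U : Filter I), a ∈ T i) ∧
      ∀ i, ∀ a ∈ T i, ∀ b ∈ T i, i ∈ E a b := by
  classical
  obtain ⟨s, hs, hsU, hs0⟩ := hinc
  -- The factor `s A.card` bounds the size of the finite sets `A` with `i ∈ g A`.
  obtain ⟨g, hgU, hmul, hgf⟩ := hgood S hS
    (fun A => s A.card ∩ {i | ∀ a ∈ A, ∀ b ∈ A, i ∈ E a b})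
    (fun A => Filter.inter_mem (hsU _) <| (Filter.eventually_all_finset A).2 fun a _ =>
      (Filter.eventually_all_finset A).2 fun b _ => hE a b)
    (fun A B hAB i hi => ⟨hs (Finset.card_le_card hAB) hi.1,
      fun a ha b hb => hi.2 a (hAB ha) b (hAB hb)⟩)
  have hmem : ∀ i (A : Finset S), A.Nonempty → (∀ a ∈ A, i ∈ g {a}) → i ∈ g A := by
    intro i A hA
    induction hA using Finset.Nonempty.cons_induction with
    | singleton a => simp
    | cons a A ha hA ih =>
      intro h
      rw [Finset.cons_eq_insert, Finset.insert_eq, hmul]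
      exact ⟨h a (Finset.mem_cons_self a A), ih fun b hb => h b (Finset.mem_cons_of_mem hb)⟩
  refine ⟨fun i => {a | i ∈ g {a}}, fun i => ?_, fun a => hgU {a}, fun i a ha b hb => ?_⟩
  · by_contra hinf
    have hi : i ∈ ⋂ n, s n := mem_iInter.2 fun n => by
      obtain ⟨A, hA, hcard⟩ := (show Set.Infinite {a | i ∈ g {a}} from hinf).exists_subset_card_eq
        (n + 1)
      have hne : A.Nonempty := Finset.card_pos.1 (hcard ▸ n.succ_pos)
      have := (hgf A (hmem i A hne fun a ha => hA ha)).1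
      exact hs (hcard ▸ n.le_succ) this
    rw [hs0] at hi
    exact hi
  · have := (hgf {a, b} (hmem i {a, b} (by simp) fun c hc => by
      rcases Finset.mem_insert.1 hc with rfl | hc
      · exact ha
      · rw [Finset.mem_singleton.1 hc]; exact hb)).2
    exact this a (by simp) b (by simp)

/-! ### Disjoint closures -/

/-- The supremum of `0` and finitely many continuous functions, which at each point is attained. -/
theorem exists_continuous_finset_sup {X : Type v} [TopologicalSpace X] {J : Type w} (T : Finset J)
    (F : J → C(X, ℝ)) : ∃ p : C(X, ℝ), (∀ t, 0 ≤ p t) ∧ (∀ j ∈ T, ∀ t, F j t ≤ p t) ∧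
      ∀ t, p t = 0 ∨ ∃ j ∈ T, p t = F j t := by
  classical
  induction T using Finset.induction_on with
  | empty => exact ⟨0, by simp⟩
  | insert a T _ ih =>
    obtain ⟨p, h0, hle, hex⟩ := ih
    refine ⟨F a ⊔ p, fun t => le_sup_of_le_right (h0 t), fun j hj t => ?_, fun t => ?_⟩
    · rcases Finset.mem_insert.1 hj with rfl | hj
      · exact le_sup_left
      · exact le_sup_of_le_right (hle j hj t)
    · rw [ContinuousMap.sup_apply]
      rcases le_total (F a t) (p t) with h | h
      · rw [sup_eq_right.2 h]
        exact (hex t).imp_right fun ⟨j, hj, e⟩ => ⟨j, Finset.mem_insert_of_mem hj, e⟩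
      · rw [sup_eq_left.2 h]
        exact Or.inr ⟨a, Finset.mem_insert_self a T, rfl⟩

/-- Urysohn's lemma in the ultracoproduct, with the function represented by a family with values
in `[0, 1]`. -/
theorem exists_family_eq_one_eq_zero {C V : Set (Ultracoproduct K U)} (hC : IsClosed C)
    (hV : IsOpen V) (hCV : C ⊆ V) :
    ∃ f : EllInfty K, (∀ i t, 0 ≤ coord f i t) ∧ (∀ i t, coord f i t ≤ 1) ∧
      (∀ φ ∈ C, φ (toUltraproduct U f) = 1) ∧ ∀ φ ∉ V, φ (toUltraproduct U f) = 0 := by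
  obtain ⟨h, h0, h1, -⟩ := exists_continuous_zero_one_of_isClosed hV.isClosed_compl hC
    (disjoint_compl_left_iff_subset.2 hCV)
  obtain ⟨a, rfl⟩ := bijective_gelfandTransform.2 h
  obtain ⟨f, rfl⟩ := Ideal.Quotient.mk_surjective a
  -- The values of `f` itself need not lie in `[0, 1]`; truncation does not change its class.
  refine ⟨clamp f, clamp_nonneg f, clamp_le_one f, fun φ hφ => ?_, fun φ hφ => ?_⟩
  · have : φ (toUltraproduct U f) = 1 := h1 hφ
    rw [character_clamp, this]
    simp
  · have : φ (toUltraproduct U f) = 0 := h0 hφ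
    rw [character_clamp, this]
    simp

theorem IsUnionOfFewClosed.isClosed {X : Type v} [TopologicalSpace X] {κ : Cardinal.{w}}
    (hκ : κ ≤ Cardinal.aleph0) {V : Set X} (hV : IsUnionOfFewClosed κ V) : IsClosed V := by
  obtain ⟨J, C, hJ, hC, rfl⟩ := hV
  have := Cardinal.lt_aleph0_iff_finite.1 (hJ.trans_le hκ)
  exact isClosed_iUnion_of_finite hC

/-- The two open sets are separated by a function. At each index only finitely many of the functions
exhausting `V` are active, their supremum is taken there, and every active function exhausting `W`
is almost orthogonal to it. -/
theorem disjoint_closure_of_isGood {κ : Cardinal.{w}} (hκ : Cardinal.aleph0 ≤ κ)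
    (hinc : CountablyIncomplete U) (hgood : IsGood κ U) {V W : Set (Ultracoproduct K U)}
    (hVo : IsOpen V) (hWo : IsOpen W) (hV : IsUnionOfFewClosed κ V) (hW : IsUnionOfFewClosed κ W)
    (hVW : Disjoint V W) : Disjoint (closure V) (closure W) := by
  classical
  obtain ⟨J, C, hJ, hC, hVC⟩ := hV
  obtain ⟨L, D, hL, hD, hWD⟩ := hW
  choose F hF0 hF1 hFC hFV using fun j =>
    exists_family_eq_one_eq_zero (hC j) hVo (hVC ▸ subset_iUnion C j)
  choose G hG0 hG1 hGD hGW using fun l =>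
    exists_family_eq_one_eq_zero (hD l) hWo (hWD ▸ subset_iUnion D l)
  have hcard : Cardinal.mk (J ⊕ L) < κ := by
    rw [Cardinal.mk_sum, Cardinal.lift_id, Cardinal.lift_id]
    exact Cardinal.add_lt_of_lt hκ hJ hL
  have hFG : ∀ j l, {i | ‖coord (F j * G l) i‖ ≤ 1 / 3} ∈ U := by
    intro j l
    refine eventually_norm_coord_le (by norm_num) fun φ => ?_
    have : φ (toUltraproduct U (F j * G l)) = 0 := by
      rw [map_mul, map_mul]
      by_cases hφ : φ ∈ V
      · rw [hGW l φ (disjoint_left.1 hVW hφ), mul_zero]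
      · rw [hFV j φ hφ, zero_mul]
    rw [this]
    norm_num
  obtain ⟨T, hTfin, hTev, hTE⟩ := hgood.exists_pointwise_finite hinc hcard
    (Sum.elim (fun j => Sum.elim (fun _ => univ) fun l => {i | ‖coord (F j * G l) i‖ ≤ 1 / 3})
      fun _ _ => univ)
    (by rintro (j | l) (j' | l') <;> simp only [Sum.elim_inl, Sum.elim_inr] <;>
        first | exact hFG _ _ | exact Filter.univ_mem)
  have hfin : ∀ i, {j : J | Sum.inl j ∈ T i}.Finite := fun i =>
    (hTfin i).preimage Sum.inl_injective.injOn
  -- The `i`-th coordinate of the separating family is the supremum of the active `F j`.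
  choose p hp0 hpge hpex using fun i =>
    exists_continuous_finset_sup (hfin i).toFinset fun j => coord (F j) i
  have hp1 : ∀ i t, p i t ≤ 1 := fun i t => by
    rcases hpex i t with h | ⟨j, -, h⟩
    · exact h.trans_le zero_le_one
    · exact h.trans_le (hF1 j i t)
  let P : EllInfty K := ofBounded p 1 fun i => (ContinuousMap.norm_le _ zero_le_one).2 fun t => by
    rw [Real.norm_of_nonneg (hp0 i t)]
    exact hp1 i t
  have hPcont : Continuous fun φ : Ultracoproduct K U => φ (toUltraproduct U P) :=
    (gelfandTransform ℝ (Ultraproduct K U) (toUltraproduct U P)).continuous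
  have hPV : V ⊆ {φ | 1 ≤ φ (toUltraproduct U P)} := fun φ hφ => by
    obtain ⟨j, hj⟩ := mem_iUnion.1 (hVC ▸ hφ)
    rw [mem_ofPred_eq, ← hFC j φ hj]
    refine character_mono φ ?_
    filter_upwards [hTev (Sum.inl j)] with i hi
    exact hpge i j ((hfin i).mem_toFinset.2 hi)
  have hPW : W ⊆ {φ | φ (toUltraproduct U P) ≤ 1 / 3} := fun φ hφ => by
    obtain ⟨l, hl⟩ := mem_iUnion.1 (hWD ▸ hφ)
    have h : φ (toUltraproduct U (P * G l)) ≤ 1 / 3 := by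
      rw [← character_smul_one φ (1 / 3)]
      refine character_mono φ ?_
      filter_upwards [hTev (Sum.inr l)] with i hi t
      have hgoal : p i t * coord (G l) i t ≤ 1 / 3 := by
        rcases hpex i t with h | ⟨j, hj, h⟩
        · rw [h, zero_mul]
          norm_num
        · have h1 : ‖coord (F j * G l) i‖ ≤ 1 / 3 :=
            hTE i (Sum.inl j) ((hfin i).mem_toFinset.1 hj) (Sum.inr l) hi
          rw [h]
          exact (le_abs_self _).trans (((coord (F j * G l) i).norm_coe_le_norm t).trans h1)
      simpa [P] using hgoal
    rwa [map_mul, map_mul, hGD l φ hl, mul_one] at h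
  refine Disjoint.mono (closure_minimal hPV (isClosed_le continuous_const hPcont))
    (closure_minimal hPW (isClosed_le hPcont continuous_const)) ?_
  refine disjoint_left.2 fun φ h1 h2 => ?_
  have := le_trans (show 1 ≤ φ (toUltraproduct U P) from h1) h2
  norm_num at this

/-- For `κ ≤ ℵ₀` the sets in question are finite unions of closed sets, hence closed, and nothing
is required of the ultrafilter. -/
theorem isFSpace_ultracoproduct {κ : Cardinal.{w}} (hinc : CountablyIncomplete U)
    (hgood : IsGood κ U) : IsFSpace κ (Ultracoproduct K U) where
  compact := inferInstance
  hausdorff := inferInstance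
  disjoint_closure V W hVo hWo hV hW hVW := by
    rcases le_total Cardinal.aleph0 κ with hκ | hκ
    · exact disjoint_closure_of_isGood hκ hinc hgood hVo hWo hV hW hVW
    · rwa [(hV.isClosed hκ).closure_eq, (hW.isClosed hκ).closure_eq]

end

end Ultracoproducts

theorem mainTheorem3 {I : Type u} (U : Ultrafilter I) (κ : Cardinal.{w})
    (hinc : Ultracoproducts.CountablyIncomplete U) (hgood : Ultracoproducts.IsGood κ U)
    (K : I → Type v) [∀ i, TopologicalSpace (K i)] [∀ i, CompactSpace (K i)]
    [∀ i, T2Space (K i)] :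
    -- the ultracoproduct (the maximal ideal space of the ultraproduct) is an `F_κ`-space
    Ultracoproducts.IsFSpace κ (Ultracoproducts.Ultracoproduct K U) ∧
    -- its points are the maximal ideals of the ultraproduct
    Function.Bijective (Ultracoproducts.toMaximalSpectrum K U) ∧
    -- the ultraproduct is its algebra of continuous functions, by the Gelfand transform
    Isometry (WeakDual.gelfandTransform ℝ (Ultracoproducts.Ultraproduct K U)) ∧
    Function.Bijective (WeakDual.gelfandTransform ℝ (Ultracoproducts.Ultraproduct K U)) ∧
    -- every compact space whose algebra of continuous functions is the ultraproduct is
    -- homeomorphic to it, and hence an `F_κ`-space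
    ∀ (L : Type x) [TopologicalSpace L] [CompactSpace L] [T2Space L],
      Ultracoproducts.RepresentsUltraproduct K U L →
        Nonempty (L ≃ₜ Ultracoproducts.Ultracoproduct K U) ∧ Ultracoproducts.IsFSpace κ L := by
  have hF := Ultracoproducts.isFSpace_ultracoproduct (K := K) hinc hgood
  refine ⟨hF, Ultracoproducts.bijective_toMaximalSpectrum,
    Ultracoproducts.isometry_gelfandTransform, Ultracoproducts.bijective_gelfandTransform,
    fun L _ _ _ ⟨e, _⟩ => ?_⟩
  obtain ⟨h⟩ := Ultracoproducts.nonempty_homeomorph_characterSpace e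
  exact ⟨⟨h⟩, hF.of_homeomorph h⟩
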